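/- Call a polynomial $p\in\mathbb R[t]$ real-rooted if $p=0$ or all complex roots of $p$ are real; for nonzero real-rooted $p$ let $\lambda_1(p)\ge\lambda_2(p)\ge\cdots$ be its roots with multiplicity. A finite family of polynomials in $\mathbb R[t]$ is compatible if every linear combination of its members with nonnegative real coefficients is real-rooted. Let $\ll$ be the smallest relation on real-rooted polynomials such that (a) if $f,g$ have positive leading coefficients, $\deg f\in\{\deg g,\deg g-1\}$ and $\lambda_1(g)\ge\lambda_1(f)\ge\lambda_2(g)\ge\lambda_2(f)\ge\cdots$ (through all the roots of $f$ and $g$), then $f\ll g$; (b) if $f\ll g$, then $g\ll -f$; (c) $0\ll f$ and $f\ll 0$ for every real-rooted $f$. **Theorem.** Let $f_1,\dots,f_n\in\mathbb R[t]$ be real-rooted (with leading coefficients of any sign), and let $\boldsymbol f=(f_1,\dots,f_n)$. Then the following are equivalent: 1. $\boldsymbol f$ is compatible; 2. $(f_i,f_j,f_k)$ is compatible for all $i,j,k\in\{1,\dots,n\}$ (not necessarily distinct). If moreover no convex combination of $\boldsymbol f$ is the zero polynomial, then (1) and (2) are also equivalent to 3. there is a nonzero real-rooted $g\in\mathbb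 R[t]$ such that $f_i\ll g$ for all $i$. -/

import Mathlib

open Polynomial

/-- A real polynomial is real-rooted if all of its complex roots are real.
The zero polynomial counts as real-rooted. -/
def RealRooted (p : ℝ[X]) : Prop :=
  p = 0 ∨ ∀ z : ℂ, aeval z p = 0 → z.im = 0

/-- The real roots of `p`, with multiplicity, in weakly decreasing order: the entry with index `i`
(counted from `0`) is `λ_{i+1}(p)`. A nonzero real-rooted `p` has exactly `deg p` entries. -/
noncomputable def rootsDesc (p : ℝ[X]) : List ℝ :=
  p.roots.sort (· ≥ ·)

/-- The chain `λ₁(g) ≥ λ₁(f) ≥ λ₂(g) ≥ λ₂(f) ≥ ⋯`, running through all roots of `f` and `g`. -/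
def RootsAlternate (f g : ℝ[X]) : Prop :=
  (∀ (i : ℕ) (hf : i < (rootsDesc f).length) (hg : i < (rootsDesc g).length),
    (rootsDesc f)[i] ≤ (rootsDesc g)[i]) ∧
  (∀ (i : ℕ) (hf : i < (rootsDesc f).length) (hg : i + 1 < (rootsDesc g).length),
    (rootsDesc g)[i + 1] ≤ (rootsDesc f)[i])

/-- `Interlaces f g` is the relation `f ≪ g` on real-rooted polynomials. For positive leading
coefficients it is interlacing of the roots; it is extended to all signs by the rule that
`f ≪ g` implies `g ≪ -f`, and by the convention `0 ≪ f` and `f ≪ 0`. -/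
inductive Interlaces : ℝ[X] → ℝ[X] → Prop
  | of_pos (f g : ℝ[X]) (hf : RealRooted f) (hg : RealRooted g)
      (hf_pos : 0 < f.leadingCoeff) (hg_pos : 0 < g.leadingCoeff)
      (hdeg : f.natDegree = g.natDegree ∨ f.natDegree + 1 = g.natDegree)
      (halt : RootsAlternate f g) : Interlaces f g
  | neg_right (f g : ℝ[X]) (h : Interlaces f g) : Interlaces g (-f)
  | zero_left (f : ℝ[X]) (hf : RealRooted f) : Interlaces 0 f
  | zero_right (f : ℝ[X]) (hf : RealRooted f) : Interlaces f 0

/-- A family is compatible if every nonnegative linear combination of it is real-rooted. -/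
def Compatible {n : ℕ} (f : Fin n → ℝ[X]) : Prop :=
  ∀ c : Fin n → ℝ, (∀ i, 0 ≤ c i) → RealRooted (∑ i, c i • f i)

/-- A family is proper if no convex combination of it is the zero polynomial. -/
def ProperFamily {n : ℕ} (f : Fin n → ℝ[X]) : Prop :=
  ∀ c : Fin n → ℝ, (∀ i, 0 ≤ c i) → ∑ i, c i = 1 → ∑ i, c i • f i ≠ 0

/-! Everything is read off from values in the upper half-plane. Triples suffice because `ℂ` is a
real plane: if a conic combination vanishes at a nonreal `z`, Carathéodory finds a relation among at
most three of the values there. Compatibility of triples makes it a relation between polynomials,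
which can be subtracted to shrink the support (`compatible_iff_triples`). A common interlacer `g`
gives `Im (f_i * conj g) ≤ 0` on the upper half-plane. This inequality survives conic combinations
and forces real-rootedness by the open mapping theorem (`compatible_of_interlaces`). Conversely, the
values of a proper compatible family at `I` lie in an open half-plane, so the continuous arguments
can be normalized to differ pairwise by less than `π`. They cannot drift to distance `π`, since a
positive combination would then vanish (`abs_phase_sub_lt`). At the real point `x` they tend to `π`
times a signed count of the roots above `x`, so these counts differ by at most one. Their maximum
over `i` is a step function whose jumps are the roots of `g`. -/

lemma RealRooted.neg {p : ℝ[X]} (h : RealRooted p) : RealRooted (-p) := by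
  rcases h with rfl | h
  · left; simp
  · right; intro z hz; exact h z (by simpa using hz)

lemma RealRooted.aeval_ne_zero {p : ℝ[X]} (h : RealRooted p) (hp : p ≠ 0) {z : ℂ}
    (hz : z.im ≠ 0) : aeval z p ≠ 0 := by
  rcases h with rfl | h
  · exact absurd rfl hp
  · exact fun h0 => hz (h z h0)

lemma RealRooted.splits {p : ℝ[X]} (h : RealRooted p) (hp : p ≠ 0) : p.Splits := by
  refine Splits.of_splits_map (algebraMap ℝ ℂ) (IsAlgClosed.splits _) fun z hz => ?_
  have hz0 : aeval z p = 0 := by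
    simpa [IsRoot, eval_map, aeval_def] using (mem_roots'.1 hz).2
  have him : z.im = 0 := by
    by_contra him
    exact h.aeval_ne_zero hp him hz0
  exact ⟨z.re, Complex.ext (by simp) (by simpa using him.symm)⟩

/-! ### Reduction to triples -/

lemma compatible_of_triples {n : ℕ} {f : Fin n → ℝ[X]}
    (h : ∀ i j k : Fin n, Compatible ![f i, f j, f k]) {ι : Type*} [Fintype ι]
    (hι : Fintype.card ι ≤ 3) (w : ι → ℝ) (hw : ∀ x, 0 ≤ w x) (j : ι → Fin n) :
    RealRooted (∑ x, w x • f (j x)) := by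
  let e := (Fintype.equivFin ι).symm
  rw [← e.sum_comp]
  -- Unused slots of the triple repeat an index with weight zero.
  have key : ∀ m ≤ 3, ∀ (v : Fin m → ℝ) (l : Fin m → Fin n), (∀ x, 0 ≤ v x) →
      RealRooted (∑ x, v x • f (l x)) := by
    intro m hm v l hv
    interval_cases m
    · left; simp
    · have := h (l 0) (l 0) (l 0) ![v 0, 0, 0] (by intro i; fin_cases i <;> simp [hv])
      simpa [Fin.sum_univ_three] using this
    · have := h (l 0) (l 1) (l 1) ![v 0, v 1, 0] (by intro i; fin_cases i <;> simp [hv])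
      simpa [Fin.sum_univ_three, Fin.sum_univ_two] using this
    · have := h (l 0) (l 1) (l 2) ![v 0, v 1, v 2] (by intro i; fin_cases i <;> simp [hv])
      simpa [Fin.sum_univ_three] using this
  exact key _ hι (fun x => w (e x)) (fun x => j (e x)) (fun x => hw _)

lemma aeval_sum_smul {ι : Type*} (s : Finset ι) (c : ι → ℝ) (f : ι → ℝ[X]) (z : ℂ) :
    aeval z (∑ i ∈ s, c i • f i) = ∑ i ∈ s, c i • aeval z (f i) := by
  simp

/-- Carathéodory: a conic relation between values in `ℂ` restricts to one of at most three terms. -/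
lemma exists_conic_relation_card_le_three {n : ℕ} {v : Fin n → ℂ} {c : Fin n → ℝ}
    (hc : ∀ i, 0 ≤ c i) (hc0 : c ≠ 0) (hsum : ∑ i, c i • v i = 0) :
    ∃ (ι : Type) (_ : Fintype ι) (w : ι → ℝ) (j : ι → Fin n), Fintype.card ι ≤ 3 ∧ Nonempty ι ∧
      (∀ x, 0 < w x) ∧ (∀ x, c (j x) ≠ 0) ∧ ∑ x, w x • v (j x) = 0 := by
  classical
  set S := Finset.univ.filter (fun i => c i ≠ 0) with hS
  have hne : ∃ i, c i ≠ 0 := by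
    by_contra! hcon
    exact hc0 (funext hcon)
  have hpos : 0 < ∑ i ∈ S, c i := by
    obtain ⟨i, hi⟩ := hne
    exact Finset.sum_pos' (fun i _ => hc i) ⟨i, by simp [hS, hi], lt_of_le_of_ne (hc i) hi.symm⟩
  have hmem : (0 : ℂ) ∈ convexHull ℝ (v '' (S : Set (Fin n))) := by
    have := S.centerMass_mem_convexHull (R := ℝ) (s := v '' (S : Set (Fin n))) (fun i _ => hc i) hpos
      (fun i hi => ⟨i, hi, rfl⟩)
    have h0 : S.centerMass c v = 0 := by
      have : ∑ i ∈ S, c i • v i = 0 := by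
        rw [← hsum, hS]
        refine Finset.sum_filter_of_ne fun i _ hi => ?_
        contrapose! hi
        simp [hi]
      rw [Finset.centerMass, this, smul_zero]
    rwa [h0] at this
  obtain ⟨ι, hfin, y, w, hy, hind, hw, hw1, hsum0⟩ := eq_pos_convex_span_of_mem_convexHull hmem
  have hch : ∀ x, ∃ i, c i ≠ 0 ∧ v i = y x := fun x => by
    obtain ⟨i, hi, hix⟩ := hy ⟨x, rfl⟩
    exact ⟨i, by simpa [hS] using hi, hix⟩
  choose j hj hjy using hch
  have hcard : Fintype.card ι ≤ 3 := by
    have h1 := hind.card_le_finrank_succ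
    have h2 := Submodule.finrank_le (vectorSpan ℝ (Set.range y))
    rw [Complex.finrank_real_complex] at h2
    omega
  have hnon : Nonempty ι := by
    by_contra hcon
    rw [not_nonempty_iff] at hcon
    simp at hw1
  let e := (Fintype.equivFin ι).symm
  refine ⟨Fin (Fintype.card ι), inferInstance, fun x => w (e x), fun x => j (e x), by simpa, ?_,
    fun x => hw _, fun x => hj _, ?_⟩
  · exact hnon.map e.symm
  · have := e.sum_comp (fun x => w x • v (j x))
    rw [this]
    simp only [hjy]
    exact hsum0

theorem compatible_iff_triples {n : ℕ} (f : Fin n → ℝ[X]) :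
    Compatible f ↔ ∀ i j k : Fin n, Compatible ![f i, f j, f k] := by
  classical
  constructor
  · intro h i j k c hc
    have := h (fun l => (if l = i then c 0 else 0) + (if l = j then c 1 else 0) +
      (if l = k then c 2 else 0)) (fun l => by
        have := hc 0; have := hc 1; have := hc 2
        split_ifs <;> linarith)
    simpa [add_smul, Finset.sum_add_distrib, ite_smul, Fin.sum_univ_three] using this
  · intro h c hc
    obtain ⟨m, hm⟩ : ∃ m, (Finset.univ.filter (fun i => c i ≠ 0)).card = m := ⟨_, rfl⟩
    induction m using Nat.strong_induction_on generalizing c with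
    | _ m ih =>
      by_contra hcon
      simp only [RealRooted, not_or, not_forall] at hcon
      obtain ⟨hp0, z, hz, him⟩ := hcon
      have hc0 : c ≠ 0 := by rintro rfl; simp at hp0
      rw [aeval_sum_smul] at hz
      obtain ⟨ι, _, w, j, hcard, ⟨x₀⟩, hw, hj, hsum⟩ := exists_conic_relation_card_le_three hc hc0 hz
      have hrr := compatible_of_triples h hcard w (fun x => (hw x).le) j
      rw [← aeval_sum_smul Finset.univ w (fun x => f (j x))] at hsum
      have hzero : ∑ x, w x • f (j x) = 0 := by
        by_contra hne
        exact hrr.aeval_ne_zero hne him hsum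
      -- The relation is pushed forward to the original indices; its support lies inside that of
      -- `c`.
      set d : Fin n → ℝ := fun i => ∑ x with j x = i, w x with hd
      have hd0 : ∀ i, 0 ≤ d i := fun i => Finset.sum_nonneg fun x _ => (hw x).le
      have hdsum : ∑ i, d i • f i = 0 := by
        rw [← hzero, ← Finset.sum_fiberwise Finset.univ j]
        refine Finset.sum_congr rfl fun i _ => ?_
        rw [hd, Finset.sum_smul]
        refine Finset.sum_congr rfl fun x hx => ?_
        rw [(Finset.mem_filter.1 hx).2]
      have hdj : 0 < d (j x₀) :=
        Finset.sum_pos' (fun x _ => (hw x).le) ⟨x₀, by simp, hw x₀⟩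
      have hdc : ∀ i, d i ≠ 0 → c i ≠ 0 := by
        intro i hi
        obtain ⟨x, hx, -⟩ := Finset.exists_ne_zero_of_sum_ne_zero hi
        rw [← (Finset.mem_filter.1 hx).2]
        exact hj x
      -- The least ratio `c i / d i` is the largest multiple of `d` that can be subtracted while all
      -- coefficients stay nonnegative; it kills the coefficient at `i₀`.
      obtain ⟨i₀, hi₀, hmin⟩ := Finset.exists_min_image
        (Finset.univ.filter (fun i => d i ≠ 0)) (fun i => c i / d i) ⟨j x₀, by simp [hdj.ne']⟩
      have hi₀' : d i₀ ≠ 0 := (Finset.mem_filter.1 hi₀).2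
      set t := c i₀ / d i₀ with ht
      have hnew : ∀ i, 0 ≤ c i - t * d i := by
        intro i
        by_cases hdi : d i = 0
        · simp [hdi, hc i]
        · have h1 := hmin i (by simp [hdi])
          have h2 : 0 < d i := lt_of_le_of_ne (hd0 i) (Ne.symm hdi)
          rw [le_div_iff₀ h2] at h1
          linarith
      have hsame : ∑ i, (c i - t * d i) • f i = ∑ i, c i • f i := by
        simp only [sub_smul, Finset.sum_sub_distrib, mul_smul, ← Finset.smul_sum, hdsum]
        simp
      have hlt : (Finset.univ.filter (fun i => c i - t * d i ≠ 0)).card < m := by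
        rw [← hm]
        refine Finset.card_lt_card (Finset.ssubset_iff_of_subset ?_ |>.2 ⟨i₀, ?_, ?_⟩)
        · intro i hi
          simp only [Finset.mem_filter, Finset.mem_univ, true_and] at hi ⊢
          intro hci
          have : d i = 0 := by
            by_contra hdi
            exact hdc i hdi hci
          simp [hci, this] at hi
        · simpa using hdc i₀ hi₀'
        · simp [ht, hi₀']
      have := ih _ hlt (fun i => c i - t * d i) hnew rfl
      rw [hsame] at this
      rcases this with h0 | h0
      · exact hp0 h0
      · exact him (h0 z (by rw [aeval_sum_smul]; exact hz))

/-! ### A common interlacer implies compatibility -/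

/-- The sum of the arguments of `z - a` over `a ∈ s`. -/
noncomputable def argSum (s : Multiset ℝ) (z : ℂ) : ℝ := (s.map fun a : ℝ => (z - a).arg).sum

lemma arg_sub_mono {z : ℂ} (hz : 0 < z.im) : Monotone fun a : ℝ => (z - a).arg := by
  intro a b hab
  by_contra! hlt
  have ha0 : z - a ≠ 0 := fun h => by simpa using hz.ne' (by simpa using congrArg Complex.im h)
  have hb0 : z - b ≠ 0 := fun h => by simpa using hz.ne' (by simpa using congrArg Complex.im h)
  have h1 : 0 ≤ (z - b).arg := Complex.arg_nonneg_iff.2 (by simpa using hz.le)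
  have h2 : (z - a).arg < Real.pi := Complex.arg_lt_pi_iff.2 (Or.inr (by simpa using hz.ne'))
  have h3 : 0 < Real.sin ((z - a).arg - (z - b).arg) :=
    Real.sin_pos_of_pos_of_lt_pi (by linarith) (by linarith)
  rw [Real.sin_sub, Complex.sin_arg, Complex.sin_arg, Complex.cos_arg ha0, Complex.cos_arg hb0,
    div_mul_div_comm, div_mul_div_comm, ← sub_div] at h3
  have h4 : 0 < ‖z - a‖ * ‖z - b‖ := mul_pos (norm_pos_iff.2 ha0) (norm_pos_iff.2 hb0)
  rw [div_pos_iff_of_pos_right h4] at h3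
  simp at h3
  nlinarith

lemma multiset_prod_eq_exp_argSum (s : Multiset ℝ) (z : ℂ) :
    (s.map fun a : ℝ => z - a).prod =
      ((s.map fun a : ℝ => ‖z - a‖).prod : ℝ) * Complex.exp (argSum s z * Complex.I) := by
  induction s using Multiset.induction_on with
  | empty => simp [argSum]
  | cons a s ih =>
    simp only [argSum, Multiset.map_cons, Multiset.prod_cons, Multiset.sum_cons] at ih ⊢
    rw [ih, Complex.ofReal_add, add_mul, Complex.exp_add, Complex.ofReal_mul]
    nth_rw 1 [← Complex.norm_mul_exp_arg_mul_I (z - a)]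
    ring

lemma RealRooted.exists_polar {p : ℝ[X]} (h : RealRooted p) (hp : p ≠ 0) {z : ℂ}
    (hz : z.im ≠ 0) :
    ∃ r : ℝ, 0 < r ∧
      aeval z p = (p.leadingCoeff * r : ℝ) * Complex.exp (argSum p.roots z * Complex.I) := by
  refine ⟨(p.roots.map fun a : ℝ => ‖z - a‖).prod, ?_, ?_⟩
  · refine Multiset.prod_pos fun x hx => ?_
    obtain ⟨a, -, rfl⟩ := Multiset.mem_map.1 hx
    refine norm_pos_iff.2 fun h => hz (by simpa using congrArg Complex.im h)
  · conv_lhs => rw [(h.splits hp).eq_prod_roots]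
    rw [Complex.ofReal_mul, mul_assoc, ← multiset_prod_eq_exp_argSum, map_mul, aeval_C,
      map_multiset_prod, Multiset.map_map]
    simp

/-- If two lists alternate, starting with `B`, then so do the partial sums of a monotone
function. -/
lemma sum_alternating_bounds {φ : ℝ → ℝ} (hφ : Monotone φ) (h0 : ∀ x, 0 ≤ φ x) :
    ∀ (A B : List ℝ) (M : ℝ),
      (A.length = B.length ∨ A.length + 1 = B.length) →
      (∀ (i : ℕ) (hA : i < A.length) (hB : i < B.length), A[i] ≤ B[i]) →
      (∀ (i : ℕ) (hA : i < A.length) (hB : i + 1 < B.length), B[i + 1] ≤ A[i]) →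
      0 ≤ M → (∀ b ∈ B.head?, φ b ≤ M) →
      0 ≤ (B.map φ).sum - (A.map φ).sum ∧ (B.map φ).sum - (A.map φ).sum ≤ M := by
  intro A B
  induction hk : A.length + B.length using Nat.strong_induction_on generalizing A B with
  | _ k ih =>
    intro M hlen h1 h2 hM hhead
    cases B with
    | nil =>
      have : A = [] := by
        rw [← List.length_eq_zero_iff]
        simpa using hlen
      subst this
      simpa using hM
    | cons b B =>
      -- Without its head `b`, the chain alternates starting with `A`, so the two lists swap roles
      -- and `φ b` becomes the new bound.
      have := ih (B.length + A.length) (by simp at hk; omega) B A rfl (φ b)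
        (by simp at hlen; omega)
        (fun i hA hB => h2 i hB (by simpa using hA))
        (fun i hA hB => h1 (i + 1) hB (by simpa using hA))
        (h0 b) (by
          cases A with
          | nil => simp
          | cons a A => simpa using hφ (show a ≤ b from h1 0 (by simp) (by simp)))
      have hb : φ b ≤ M := by simpa using hhead
      simp only [List.map_cons, List.sum_cons]
      constructor <;> linarith [this.1, this.2]

lemma argSum_roots (p : ℝ[X]) (z : ℂ) :
    argSum p.roots z = ((rootsDesc p).map fun a : ℝ => (z - a).arg).sum := by
  rw [argSum, rootsDesc]
  conv_lhs => rw [← Multiset.sort_eq p.roots (· ≥ ·)]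
  rw [Multiset.map_coe, Multiset.sum_coe]

lemma length_rootsDesc {p : ℝ[X]} (h : RealRooted p) (hp : p ≠ 0) :
    (rootsDesc p).length = p.natDegree := by
  rw [rootsDesc, Multiset.length_sort, (h.splits hp).natDegree_eq_card_roots]

/-- For positive leading coefficients, the difference of arguments `arg g - arg f` is an alternating
sum of monotone angles in `[0, π]`, hence itself in `[0, π]`, and its sine is nonnegative. The sign
rule preserves the inequality. -/
lemma Interlaces.im_mul_conj_nonpos {f g : ℝ[X]} (h : Interlaces f g) {z : ℂ} (hz : 0 < z.im) :
    (aeval z f * (starRingEnd ℂ) (aeval z g)).im ≤ 0 := by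
  induction h with
  | of_pos f g hf hg hf_pos hg_pos hdeg halt =>
    have hf0 : f ≠ 0 := by rintro rfl; simp at hf_pos
    have hg0 : g ≠ 0 := by rintro rfl; simp at hg_pos
    obtain ⟨r, hr, hfr⟩ := hf.exists_polar hf0 hz.ne'
    obtain ⟨s, hs, hgs⟩ := hg.exists_polar hg0 hz.ne'
    have hb := sum_alternating_bounds (arg_sub_mono hz)
      (fun a => Complex.arg_nonneg_iff.2 (by simpa using hz.le)) (rootsDesc f) (rootsDesc g)
      Real.pi (by rwa [length_rootsDesc hf hf0, length_rootsDesc hg hg0]) halt.1 halt.2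
      Real.pi_pos.le (fun b _ => Complex.arg_le_pi _)
    rw [← argSum_roots, ← argSum_roots] at hb
    have hsin := Real.sin_nonneg_of_nonneg_of_le_pi hb.1 hb.2
    rw [Real.sin_sub] at hsin
    have hpos : 0 ≤ f.leadingCoeff * r * (g.leadingCoeff * s) := by positivity
    have := mul_nonneg hpos hsin
    rw [hfr, hgs, Complex.exp_mul_I, Complex.exp_mul_I, ← Complex.ofReal_cos, ← Complex.ofReal_sin,
      ← Complex.ofReal_cos, ← Complex.ofReal_sin]
    simp only [map_mul, map_add, Complex.conj_ofReal, Complex.conj_I, Complex.mul_im,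
      Complex.mul_re, Complex.add_re, Complex.add_im, Complex.ofReal_re, Complex.ofReal_im,
      Complex.I_re, Complex.I_im, Complex.neg_re, Complex.neg_im]
    linarith
  | neg_right f g h ih =>
    simp only [map_neg, mul_neg, Complex.neg_im, Complex.mul_im, Complex.conj_re,
      Complex.conj_im] at ih ⊢
    linarith
  | zero_left f hf => simp
  | zero_right f hf => simp

/-- A polynomial whose quotient by a real-rooted `g` maps the upper half-plane to the closed lower
half-plane is real-rooted. -/
lemma RealRooted.of_im_mul_conj_nonpos {p g : ℝ[X]} (hg : RealRooted g) (hg0 : g ≠ 0)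
    (h : ∀ z : ℂ, 0 < z.im → (aeval z p * (starRingEnd ℂ) (aeval z g)).im ≤ 0) :
    RealRooted p := by
  by_contra hcon
  simp only [RealRooted, not_or, not_forall] at hcon
  obtain ⟨hp0, z, hz, him⟩ := hcon
  obtain ⟨w, hw, hwim⟩ : ∃ w : ℂ, aeval w p = 0 ∧ 0 < w.im := by
    rcases lt_or_gt_of_ne him with hlt | hgt
    · exact ⟨(starRingEnd ℂ) z, by rw [Polynomial.aeval_conj, hz, map_zero], by simpa using hlt⟩
    · exact ⟨z, hz, hgt⟩
  set U : Set ℂ := {z | 0 < z.im} with hU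
  have hUo : IsOpen U := isOpen_lt continuous_const Complex.continuous_im
  have hUc : IsPreconnected U := (convex_halfSpace_im_gt 0).isPreconnected
  have hgU : ∀ z ∈ U, aeval z g ≠ 0 := fun z hz => hg.aeval_ne_zero hg0 (ne_of_gt hz)
  have han : AnalyticOnNhd ℂ (fun z => aeval z p / aeval z g) U := by
    refine DifferentiableOn.analyticOnNhd (fun z hz => ?_) hUo
    exact ((p.differentiable_aeval z).div (g.differentiable_aeval z)
      (hgU z hz)).differentiableWithinAt
  have him_le : ∀ z ∈ U, (aeval z p / aeval z g).im ≤ 0 := by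
    intro z hz
    have h1 := h z hz
    have h2 : aeval z p / aeval z g =
        (aeval z p * (starRingEnd ℂ) (aeval z g)) / (Complex.normSq (aeval z g) : ℝ) := by
      rw [Complex.normSq_eq_conj_mul_self]
      have h3 := hgU z hz
      have h4 : (starRingEnd ℂ) (aeval z g) ≠ 0 := by simpa using h3
      field_simp
    rw [h2, Complex.div_ofReal_im]
    exact div_nonpos_of_nonpos_of_nonneg h1 (Complex.normSq_nonneg _)
  -- The quotient vanishes at `w`. If it is open, its image contains a disc about `0`, hence points
  -- of positive imaginary part.
  rcases han.is_constant_or_isOpen hUc with ⟨c, hc⟩ | hopen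
  · have hc0 : c = 0 := by
      rw [← hc w hwim, hw, zero_div]
    have hroots : ∀ z ∈ U, aeval z p = 0 := by
      intro z hz
      have := hc z hz
      rw [hc0, div_eq_zero_iff] at this
      exact this.resolve_right (hgU z hz)
    have hinf : U.Infinite := by
      refine Set.infinite_of_injective_forall_mem (f := fun n : ℕ => (n : ℂ) + Complex.I) ?_ ?_
      · intro a b hab
        simpa using hab
      · intro n
        simp [hU]
    have hmap : p.map (algebraMap ℝ ℂ) = 0 := by
      refine Polynomial.eq_zero_of_infinite_isRoot _ (hinf.mono fun z hz => ?_)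
      have := hroots z hz
      simpa [IsRoot, eval_map, aeval_def] using this
    exact hp0 ((Polynomial.map_eq_zero _).1 hmap)
  · have hV := hopen U subset_rfl hUo
    have h0 : (0 : ℂ) ∈ (fun z => aeval z p / aeval z g) '' U := ⟨w, hwim, by simp [hw]⟩
    obtain ⟨ε, hε, hball⟩ := Metric.isOpen_iff.1 hV 0 h0
    have hmem : ((ε / 2 : ℝ) : ℂ) * Complex.I ∈ Metric.ball (0 : ℂ) ε := by
      simp [abs_of_pos hε, hε]
    obtain ⟨z, hz, hzeq⟩ := hball hmem
    have := him_le z hz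
    simp only at hzeq
    rw [hzeq] at this
    simp at this
    linarith

theorem compatible_of_interlaces {n : ℕ} {f : Fin n → ℝ[X]} {g : ℝ[X]} (hg0 : g ≠ 0)
    (hg : RealRooted g) (h : ∀ i, Interlaces (f i) g) : Compatible f := by
  intro c hc
  refine RealRooted.of_im_mul_conj_nonpos hg hg0 fun z hz => ?_
  rw [aeval_sum_smul, Finset.sum_mul, Complex.im_sum]
  refine Finset.sum_nonpos fun i _ => ?_
  rw [smul_mul_assoc, Complex.smul_im, smul_eq_mul]
  exact mul_nonpos_of_nonneg_of_nonpos (hc i) ((h i).im_mul_conj_nonpos hz)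
-- Root counts and interlacing
open Filter Topology

/-- The number of elements of `s` above `x`, with multiplicity. -/
noncomputable def countAbove (s : Multiset ℝ) (x : ℝ) : ℕ := s.countP (x < ·)

lemma countAbove_cons (a : ℝ) (s : Multiset ℝ) (x : ℝ) :
    countAbove (a ::ₘ s) x = countAbove s x + if x < a then 1 else 0 :=
  Multiset.countP_cons _ _ _

lemma countAbove_antitone (s : Multiset ℝ) : Antitone (countAbove s) := by
  intro x y hxy
  simp only [countAbove, Multiset.countP_eq_card_filter]
  exact Multiset.card_le_card (Multiset.monotone_filter_right s fun a h => lt_of_le_of_lt hxy h)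

lemma countAbove_le_card (s : Multiset ℝ) (x : ℝ) : countAbove s x ≤ s.card :=
  Multiset.countP_le_card _ _

lemma eventually_countAbove_ge (s : Multiset ℝ) (x : ℝ) :
    ∀ᶠ y in 𝓝 x, countAbove s x ≤ countAbove s y := by
  induction s using Multiset.induction_on with
  | empty => simp [countAbove]
  | cons a s ih =>
    have : ∀ᶠ y in 𝓝 x, x < a → y < a := by
      by_cases h : x < a
      · filter_upwards [Iio_mem_nhds h] with y hy _ using hy
      · simp [h]
    filter_upwards [ih, this] with y h1 h2
    rw [countAbove_cons, countAbove_cons]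
    split_ifs <;> first | omega | (exfalso; tauto)

lemma countAbove_atTop (s : Multiset ℝ) : ∀ᶠ x in atTop, countAbove s x = 0 := by
  induction s using Multiset.induction_on with
  | empty => simp [countAbove]
  | cons a s ih =>
    filter_upwards [ih, eventually_ge_atTop a] with x h1 h2
    rw [countAbove_cons, h1, if_neg (not_lt.2 h2)]

lemma countAbove_atBot (s : Multiset ℝ) : ∀ᶠ x in atBot, countAbove s x = s.card := by
  induction s using Multiset.induction_on with
  | empty => simp [countAbove]
  | cons a s ih =>
    filter_upwards [ih, eventually_lt_atBot a] with x h1 h2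
    rw [countAbove_cons, h1, if_pos h2, Multiset.card_cons]

lemma eq_Iio_csSup {S : Set ℝ} (ho : IsOpen S) (hl : IsLowerSet S) (hne : S.Nonempty)
    (hbdd : BddAbove S) : S = Set.Iio (sSup S) := by
  ext x
  constructor
  · intro hx
    obtain ⟨ε, hε, hb⟩ := Metric.isOpen_iff.1 ho x hx
    have : x + ε / 2 ∈ S := hb (by simp [abs_of_pos hε, hε])
    have := le_csSup hbdd this
    simp only [Set.mem_Iio]
    linarith
  · intro hx
    obtain ⟨y, hy, hxy⟩ := exists_lt_of_lt_csSup hne hx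
    exact hl hxy.le hy

/-- A bounded antitone lower semicontinuous integer-valued step function counts the elements of a
multiset above a point, up to an additive constant. -/
lemma exists_eq_add_countAbove {K : ℝ → ℤ} (hK : Antitone K) (ho : ∀ j, IsOpen {x | j ≤ K x})
    {m M : ℤ} (hm : ∀ x, m ≤ K x) (hM : ∀ x, K x ≤ M) :
    ∃ (e : ℤ) (u : Multiset ℝ), ∀ x, K x = e + countAbove u x := by
  obtain ⟨lo, ⟨xlo, hxlo⟩, hlo⟩ := Int.exists_least_of_bdd (P := fun j => ∃ x, K x = j)
    ⟨m, by rintro _ ⟨x, rfl⟩; exact hm x⟩ ⟨K 0, 0, rfl⟩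
  obtain ⟨hi, ⟨xhi, hxhi⟩, hhi⟩ := Int.exists_greatest_of_bdd (P := fun j => ∃ x, K x = j)
    ⟨M, by rintro _ ⟨x, rfl⟩; exact hM x⟩ ⟨K 0, 0, rfl⟩
  -- Each superlevel set is an open left ray; the endpoints of these rays form the multiset.
  have hset : ∀ j ∈ Finset.Ioc lo hi, ∀ x, j ≤ K x ↔ x < sSup {x | j ≤ K x} := by
    intro j hj x
    rw [Finset.mem_Ioc] at hj
    have := eq_Iio_csSup (ho j) (fun a b hab (ha : j ≤ K a) => ha.trans (hK hab))
      ⟨xhi, by simpa [hxhi] using hj.2⟩ ⟨xlo, fun y (hy : j ≤ K y) => by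
        by_contra! hlt
        have := hK hlt.le
        omega⟩
    exact Set.ext_iff.1 this x
  refine ⟨lo, (Finset.Ioc lo hi).val.map fun j => sSup {x | j ≤ K x}, fun x => ?_⟩
  have h1 := hlo (K x) ⟨x, rfl⟩
  have h2 := hhi (K x) ⟨x, rfl⟩
  have hcount : countAbove ((Finset.Ioc lo hi).val.map fun j => sSup {x | j ≤ K x}) x =
      (Finset.Ioc lo (K x)).card := by
    rw [countAbove, Multiset.countP_map, ← Finset.filter_val, Finset.card_val]
    congr 1
    ext j
    simp only [Finset.mem_filter]
    constructor
    · rintro ⟨hj, hx⟩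
      exact Finset.mem_Ioc.2 ⟨(Finset.mem_Ioc.1 hj).1, (hset j hj x).2 hx⟩
    · intro hj
      rw [Finset.mem_Ioc] at hj
      have hj' : j ∈ Finset.Ioc lo hi := Finset.mem_Ioc.2 ⟨hj.1, hj.2.trans h2⟩
      exact ⟨hj', (hset j hj' x).1 hj.2⟩
  rw [hcount, Int.card_Ioc]
  omega

lemma List.countP_le_of_pairwise_ge {L : List ℝ} (hL : L.Pairwise (· ≥ ·)) {i : ℕ}
    (hi : i < L.length) : L.countP (L[i] < ·) ≤ i := by
  have h : L.countP (L[i] < ·) = (L.take i).countP (L[i] < ·) + (L.drop i).countP (L[i] < ·) := by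
    rw [← List.countP_append, List.take_append_drop]
  have h0 : (L.drop i).countP (L[i] < ·) = 0 := by
    rw [List.countP_eq_zero]
    intro a ha
    obtain ⟨j, hj, rfl⟩ := List.mem_drop_iff_getElem.1 ha
    have : L[i] ≥ L[i + j] := by
      rcases Nat.eq_zero_or_pos j with rfl | hpos
      · simp
      · exact List.pairwise_iff_getElem.1 hL _ _ _ _ (by omega)
    simpa [Nat.add_comm] using this
  have h1 : (L.take i).countP (L[i] < ·) ≤ (L.take i).length := List.countP_le_length
  rw [h, h0]
  simpa using h1.trans (by simp)

lemma List.lt_countP_of_pairwise_ge {L : List ℝ} (hL : L.Pairwise (· ≥ ·)) {i : ℕ}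
    (hi : i < L.length) {x : ℝ} (hx : x < L[i]) : i < L.countP (x < ·) := by
  have h : L.countP (x < ·) =
      (L.take (i + 1)).countP (x < ·) + (L.drop (i + 1)).countP (x < ·) := by
    rw [← List.countP_append, List.take_append_drop]
  have h1 : (L.take (i + 1)).countP (x < ·) = (L.take (i + 1)).length := by
    rw [List.countP_eq_length]
    intro a ha
    obtain ⟨j, hj, rfl⟩ := List.mem_take_iff_getElem.1 ha
    have : L[j] ≥ L[i] := by
      rcases Nat.lt_or_ge j i with hlt | hge
      · exact List.pairwise_iff_getElem.1 hL _ _ _ _ hlt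
      · obtain rfl : j = i := by omega
        exact le_refl _
    simpa using lt_of_lt_of_le hx this
  rw [h, h1, List.length_take]
  omega

lemma countAbove_roots (p : ℝ[X]) (x : ℝ) :
    countAbove p.roots x = (rootsDesc p).countP (x < ·) := by
  rw [countAbove, rootsDesc]
  conv_lhs => rw [← Multiset.sort_eq p.roots (· ≥ ·)]
  rw [Multiset.coe_countP]

/-- If the chain fails at some pair of roots, the counts at the smaller of the two contradict a
hypothesis. -/
lemma rootsAlternate_of_countAbove {f g : ℝ[X]}
    (h1 : ∀ x, countAbove f.roots x ≤ countAbove g.roots x)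
    (h2 : ∀ x, countAbove g.roots x ≤ countAbove f.roots x + 1) : RootsAlternate f g := by
  have hf : (rootsDesc f).Pairwise (· ≥ ·) := Multiset.pairwise_sort _ _
  have hg : (rootsDesc g).Pairwise (· ≥ ·) := Multiset.pairwise_sort _ _
  simp only [countAbove_roots] at h1 h2
  constructor
  · intro i hfi hgi
    by_contra! hlt
    have := h1 (rootsDesc g)[i]
    have := List.countP_le_of_pairwise_ge hg hgi
    have := List.lt_countP_of_pairwise_ge hf hfi hlt
    omega
  · intro i hfi hgi
    by_contra! hlt
    have := h2 (rootsDesc f)[i]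
    have := List.countP_le_of_pairwise_ge hf hfi
    have := List.lt_countP_of_pairwise_ge hg hgi hlt
    omega

lemma interlaces_of_countAbove {f g : ℝ[X]} (hf : RealRooted f) (hg : RealRooted g)
    (hf_pos : 0 < f.leadingCoeff) (hg_pos : 0 < g.leadingCoeff)
    (h1 : ∀ x, countAbove f.roots x ≤ countAbove g.roots x)
    (h2 : ∀ x, countAbove g.roots x ≤ countAbove f.roots x + 1) : Interlaces f g := by
  refine .of_pos f g hf hg hf_pos hg_pos ?_ (rootsAlternate_of_countAbove h1 h2)
  have hf0 : f ≠ 0 := by rintro rfl; simp at hf_pos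
  have hg0 : g ≠ 0 := by rintro rfl; simp at hg_pos
  -- Far to the left the counts are the degrees.
  obtain ⟨x, hxf, hxg⟩ := ((countAbove_atBot f.roots).and (countAbove_atBot g.roots)).exists
  have := h1 x
  have := h2 x
  rw [(hf.splits hf0).natDegree_eq_card_roots, (hg.splits hg0).natDegree_eq_card_roots]
  omega

lemma Interlaces.of_neg_neg {f g : ℝ[X]} (h : Interlaces (-f) (-g)) : Interlaces f g := by
  simpa using h.neg_right.neg_right

/-- Interlacing for polynomials of any sign: `e` and `d` record the signs of the leading
coefficients. -/
lemma interlaces_of_signed_countAbove {f g : ℝ[X]} (hf : RealRooted f) (hg : RealRooted g)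
    {d e : ℤ} (hfd : 0 < (-1) ^ d * f.leadingCoeff) (hge : 0 < (-1) ^ e * g.leadingCoeff)
    (h1 : ∀ x, d + countAbove f.roots x ≤ e + countAbove g.roots x)
    (h2 : ∀ x, e + countAbove g.roots x ≤ d + countAbove f.roots x + 1) : Interlaces f g := by
  -- Far to the right the counts vanish, so `e` is `d` or `d + 1`, and the parities decide which.
  obtain ⟨x, hxf, hxg⟩ := ((countAbove_atTop f.roots).and (countAbove_atTop g.roots)).exists
  have hx1 := h1 x
  have hx2 := h2 x
  rw [hxf, hxg] at hx1 hx2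
  rcases Int.even_or_odd d with hd | hd <;> rcases Int.even_or_odd e with he | he <;>
    simp only [hd.neg_one_zpow, he.neg_one_zpow, one_mul, neg_one_mul] at hfd hge
  · obtain rfl : e = d := by obtain ⟨a, rfl⟩ := hd; obtain ⟨b, rfl⟩ := he; omega
    exact interlaces_of_countAbove hf hg hfd hge (fun x => by have := h1 x; omega)
      (fun x => by have := h2 x; omega)
  · obtain rfl : e = d + 1 := by obtain ⟨a, rfl⟩ := hd; obtain ⟨b, rfl⟩ := he; omega
    have := interlaces_of_countAbove hg.neg hf (by simpa using hge) hfd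
      (fun x => by have := h2 x; rw [roots_neg]; omega)
      (fun x => by have := h1 x; rw [roots_neg]; omega)
    simpa using this.neg_right
  · obtain rfl : e = d + 1 := by obtain ⟨a, rfl⟩ := hd; obtain ⟨b, rfl⟩ := he; omega
    have := interlaces_of_countAbove hg hf.neg hge (by simpa using hfd)
      (fun x => by have := h2 x; rw [roots_neg]; omega)
      (fun x => by have := h1 x; rw [roots_neg]; omega)
    exact this.neg_right.of_neg_neg
  · obtain rfl : e = d := by obtain ⟨a, rfl⟩ := hd; obtain ⟨b, rfl⟩ := he; omega
    exact (interlaces_of_countAbove hf.neg hg.neg (by simpa using hfd) (by simpa using hge)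
      (fun x => by have := h1 x; simp only [roots_neg]; omega)
      (fun x => by have := h2 x; simp only [roots_neg]; omega)).of_neg_neg

/-! ### Phases and their boundary values -/

lemma continuousOn_argSum (s : Multiset ℝ) : ContinuousOn (argSum s) {z | 0 < z.im} := by
  induction s using Multiset.induction_on with
  | empty =>
    have : argSum 0 = fun _ => 0 := by funext z; simp [argSum]
    rw [this]
    exact continuousOn_const
  | cons a s ih =>
    have h : ContinuousOn (fun z : ℂ => (z - a).arg) {z | 0 < z.im} := by
      intro z hz
      have hmem : z - a ∈ Complex.slitPlane := Or.inr (by simpa using (ne_of_gt hz))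
      exact ((Complex.continuousAt_arg hmem).comp (f := fun z : ℂ => z - a)
        (by fun_prop)).continuousWithinAt
    have hsum : argSum (a ::ₘ s) = fun z : ℂ => (z - a).arg + argSum s z := by
      funext z
      simp [argSum]
    rw [hsum]
    exact h.add ih

/-- A path in the upper half-plane that approaches the real point `x` tangentially from the
right. -/
noncomputable def tangentPath (x t : ℝ) : ℂ := ⟨x + t, t ^ 2⟩

lemma continuous_tangentPath (x : ℝ) : Continuous (tangentPath x) := by
  have : tangentPath x = fun t : ℝ => ((x + t : ℝ) : ℂ) + ((t ^ 2 : ℝ) : ℂ) * Complex.I := by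
    funext t
    apply Complex.ext <;> simp [tangentPath, -Complex.ofReal_pow]
  rw [this]
  fun_prop

lemma tendsto_arg_tangentPath_sub (x a : ℝ) :
    Tendsto (fun t : ℝ => (tangentPath x t - a).arg) (𝓝[>] 0)
      (𝓝 (if x < a then Real.pi else 0)) := by
  have hcont : Continuous fun t : ℝ => tangentPath x t - a :=
    (continuous_tangentPath x).sub continuous_const
  have h0 : tangentPath x 0 - a = ((x - a : ℝ) : ℂ) := by
    apply Complex.ext <;> simp [tangentPath]
  rcases lt_trichotomy x a with h | rfl | h
  · rw [if_pos h]
    have hlim := Complex.tendsto_arg_nhdsWithin_im_nonneg_of_re_neg_of_im_zero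
      (z := ((x - a : ℝ) : ℂ)) (by simpa using h) (by simp)
    refine hlim.comp (tendsto_nhdsWithin_iff.2 ⟨?_, ?_⟩)
    · rw [← h0]
      exact hcont.continuousAt.tendsto.mono_left nhdsWithin_le_nhds
    · exact Eventually.of_forall fun t => by simp [tangentPath, sq_nonneg]
  -- Here the difference is `t * (1 + t * I)`. Tangency makes its argument tend to `0`, so a root at
  -- `x` itself is not counted, in agreement with the strict `countAbove`.
  · rw [if_neg (lt_irrefl _)]
    have hc : ContinuousAt (fun t : ℝ => ((⟨1, t⟩ : ℂ)).arg) 0 := by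
      have h1 : ContinuousAt Complex.arg (⟨1, 0⟩ : ℂ) :=
        Complex.continuousAt_arg (Or.inl (by simp))
      have h2 : Continuous fun t : ℝ => (⟨1, t⟩ : ℂ) := by
        have : (fun t : ℝ => (⟨1, t⟩ : ℂ)) = fun t : ℝ => 1 + (t : ℂ) * Complex.I := by
          funext t
          apply Complex.ext <;> simp
        rw [this]
        fun_prop
      exact ContinuousAt.comp (f := fun t : ℝ => (⟨1, t⟩ : ℂ)) h1 h2.continuousAt
    have hz : ((⟨1, 0⟩ : ℂ)).arg = 0 := by
      rw [Complex.arg_eq_zero_iff]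
      simp
    have := hc.tendsto
    rw [hz] at this
    refine (this.mono_left nhdsWithin_le_nhds).congr' ?_
    filter_upwards [self_mem_nhdsWithin] with t ht
    rw [← Complex.arg_real_mul _ (Set.mem_Ioi.1 ht)]
    congr 1
    apply Complex.ext <;> simp [tangentPath, sq]
  · rw [if_neg h.not_gt]
    have h1 : ContinuousAt Complex.arg (tangentPath x 0 - a) := by
      rw [h0]
      exact Complex.continuousAt_arg (Or.inl (by simpa using h))
    have h2 := (ContinuousAt.comp (f := fun t : ℝ => tangentPath x t - a) h1
      hcont.continuousAt).tendsto
    simp only [Function.comp_def] at h2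
    rw [h0, Complex.arg_ofReal_of_nonneg (sub_nonneg.2 h.le)] at h2
    exact h2.mono_left nhdsWithin_le_nhds

lemma tendsto_argSum_tangentPath (s : Multiset ℝ) (x : ℝ) :
    Tendsto (fun t : ℝ => argSum s (tangentPath x t)) (𝓝[>] 0)
      (𝓝 (Real.pi * countAbove s x)) := by
  induction s using Multiset.induction_on with
  | empty => simp [argSum, countAbove]
  | cons a s ih =>
    have := (tendsto_arg_tangentPath_sub x a).add ih
    rw [countAbove_cons]
    convert! this using 2
    · simp [argSum]
    · split_ifs <;> push_cast <;> ring

/-- The continuous argument of a real-rooted polynomial on the upper half-plane, normalized by the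
integer `e`. -/
noncomputable def phase (p : ℝ[X]) (e : ℤ) (z : ℂ) : ℝ := argSum p.roots z + Real.pi * e

lemma exp_int_mul_pi (e : ℤ) : Complex.exp ((Real.pi * e : ℝ) * Complex.I) = ((-1 : ℝ) ^ e : ℝ) := by
  have : ((Real.pi * e : ℝ) : ℂ) * Complex.I = e * (Real.pi * Complex.I) := by push_cast; ring
  rw [this, Complex.exp_int_mul, Complex.exp_pi_mul_I]
  push_cast
  rfl

lemma RealRooted.exists_pos_mul_exp_phase {p : ℝ[X]} (h : RealRooted p) (hp : p ≠ 0) {e : ℤ}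
    (he : 0 < (-1) ^ e * p.leadingCoeff) {z : ℂ} (hz : z.im ≠ 0) :
    ∃ r : ℝ, 0 < r ∧ aeval z p = r * Complex.exp (phase p e z * Complex.I) := by
  obtain ⟨r, hr, hpr⟩ := h.exists_polar hp hz
  refine ⟨(-1) ^ e * p.leadingCoeff * r, mul_pos he hr, ?_⟩
  have hsq : ((-1 : ℝ) ^ e) * (-1) ^ e = 1 := by
    rw [← mul_zpow]; simp
  rw [hpr, phase, Complex.ofReal_add, add_mul, Complex.exp_add, exp_int_mul_pi]
  have : (((-1 : ℝ) ^ e : ℝ) : ℂ) * (((-1 : ℝ) ^ e : ℝ) : ℂ) = 1 := by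
    rw [← Complex.ofReal_mul, hsq, Complex.ofReal_one]
  rw [Complex.ofReal_mul (_ * _), Complex.ofReal_mul ((-1) ^ e), Complex.ofReal_mul]
  linear_combination (-(p.leadingCoeff : ℂ) * r * Complex.exp (argSum p.roots z * Complex.I)) * this

/-- Two phases that differ by less than `π` somewhere do so everywhere, if no positive combination
of the polynomials vanishes in the upper half-plane. -/
lemma abs_phase_sub_lt {f g : ℝ[X]} (hf : RealRooted f) (hg : RealRooted g) (hf0 : f ≠ 0)
    (hg0 : g ≠ 0) {d e : ℤ} (hd : 0 < (-1) ^ d * f.leadingCoeff)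
    (he : 0 < (-1) ^ e * g.leadingCoeff)
    (h : ∀ z : ℂ, 0 < z.im → ∀ a b : ℝ, 0 < a → 0 < b → a • aeval z f + b • aeval z g ≠ 0)
    {z₀ : ℂ} (hz₀ : 0 < z₀.im) (hlt : |phase f d z₀ - phase g e z₀| < Real.pi) {z : ℂ}
    (hz : 0 < z.im) : |phase f d z - phase g e z| < Real.pi := by
  by_contra! hge
  have hUc : IsPreconnected {z : ℂ | 0 < z.im} := (convex_halfSpace_im_gt 0).isPreconnected
  have hcont : ContinuousOn (fun z => |phase f d z - phase g e z|) {z | 0 < z.im} :=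
    (((continuousOn_argSum f.roots).add continuousOn_const).sub
      ((continuousOn_argSum g.roots).add continuousOn_const)).abs
  -- At `w` the phases differ by exactly `π`: the values point in opposite directions and a positive
  -- combination cancels them.
  obtain ⟨w, hw, hweq⟩ := hUc.intermediate_value hz₀ hz hcont ⟨hlt.le, hge⟩
  obtain ⟨r, hr, hfr⟩ := hf.exists_pos_mul_exp_phase hf0 hd (ne_of_gt hw)
  obtain ⟨s, hs, hgs⟩ := hg.exists_pos_mul_exp_phase hg0 he (ne_of_gt hw)
  apply h w hw s r hs hr
  have hexp : Complex.exp (phase f d w * Complex.I) = -Complex.exp (phase g e w * Complex.I) := by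
    rcases (abs_eq Real.pi_pos.le).1 hweq with h1 | h1
    · have : phase f d w = phase g e w + Real.pi := by linarith
      rw [this, Complex.ofReal_add, add_mul, Complex.exp_add, Complex.exp_pi_mul_I]
      ring
    · have : phase g e w = phase f d w + Real.pi := by linarith
      rw [this, Complex.ofReal_add, add_mul, Complex.exp_add, Complex.exp_pi_mul_I]
      ring
  rw [hfr, hgs, hexp, Complex.real_smul, Complex.real_smul]
  ring

/-- In the limit along `tangentPath` the strict bound becomes `≤ π`; dividing by `π` leaves an
inequality of integers. -/
lemma countAbove_add_le {f g : ℝ[X]} {d e : ℤ}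
    (h : ∀ z : ℂ, 0 < z.im → |phase f d z - phase g e z| < Real.pi) (x : ℝ) :
    d + (countAbove f.roots x : ℤ) ≤ e + countAbove g.roots x + 1 := by
  have hlim := ((tendsto_argSum_tangentPath f.roots x).add_const (Real.pi * d)).sub
    ((tendsto_argSum_tangentPath g.roots x).add_const (Real.pi * e))
  have hle := le_of_tendsto hlim (b := Real.pi) (by
    filter_upwards [self_mem_nhdsWithin] with t ht
    have ht : 0 < t := ht
    exact (abs_lt.1 (h (tangentPath x t) (by simp only [tangentPath]; positivity))).2.le)
  have h1 : Real.pi * ((d : ℝ) + countAbove f.roots x - (e + countAbove g.roots x)) ≤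
      Real.pi * 1 := by linarith
  have h2 := le_of_mul_le_mul_left h1 Real.pi_pos
  have h3 : ((d + (countAbove f.roots x : ℤ) - (e + countAbove g.roots x) : ℤ) : ℝ) ≤ (1 : ℤ) := by
    push_cast
    exact h2
  have := Int.cast_le.1 h3
  omega

/-- If a real-rooted polynomial has value in the half-plane `0 < re (· * w)`, then its phase can be
normalized to differ by less than `π / 2` from `-arg w`. -/
lemma RealRooted.exists_phase_near {p : ℝ[X]} (h : RealRooted p) (hp : p ≠ 0) {z w : ℂ}
    (hz : z.im ≠ 0) (hw : 0 < (aeval z p * w).re) :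
    ∃ e : ℤ, 0 < (-1) ^ e * p.leadingCoeff ∧ |phase p e z + w.arg| < Real.pi / 2 := by
  obtain ⟨e₀, he₀⟩ : ∃ e : ℤ, 0 < (-1) ^ e * p.leadingCoeff := by
    rcases lt_or_gt_of_ne (leadingCoeff_ne_zero.2 hp) with hlt | hgt
    · exact ⟨1, by simpa using hlt⟩
    · exact ⟨0, by simpa using hgt⟩
  obtain ⟨r, hr, hpr⟩ := h.exists_pos_mul_exp_phase hp he₀ hz
  have hw0 : w ≠ 0 := by rintro rfl; simp at hw
  have hwn : 0 < ‖w‖ := norm_pos_iff.2 hw0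
  have hprod : aeval z p * w =
      ((r * ‖w‖ : ℝ) : ℂ) * Complex.exp ((phase p e₀ z + w.arg : ℝ) * Complex.I) := by
    conv_lhs => rw [hpr, ← Complex.norm_mul_exp_arg_mul_I w]
    rw [Complex.ofReal_add, add_mul, Complex.exp_add, Complex.ofReal_mul]
    ring
  have harg : |(aeval z p * w).arg| < Real.pi / 2 := Complex.abs_arg_lt_pi_div_two_iff.2 (Or.inl hw)
  rw [hprod, Complex.arg_real_mul _ (mul_pos hr hwn), Complex.arg_exp_mul_I,
    ← self_sub_toIocDiv_zsmul] at harg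
  set m := toIocDiv Real.two_pi_pos (-Real.pi) (phase p e₀ z + w.arg)
  -- Removing `m` full turns changes the normalization by an even integer, which preserves the sign
  -- condition.
  refine ⟨e₀ - 2 * m, ?_, ?_⟩
  · rw [zpow_sub₀ (by norm_num), zpow_mul]
    simpa using he₀
  · convert! harg using 2
    simp only [phase, zsmul_eq_mul]
    push_cast
    ring

lemma RealRooted.C_mul_prod {c : ℝ} (hc : c ≠ 0) (u : Multiset ℝ) :
    RealRooted (C c * (u.map fun a => X - C a).prod) := by
  refine Or.inr fun z hz => ?_
  rw [map_mul, aeval_C, mul_eq_zero, map_multiset_prod, Multiset.map_map,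
    Multiset.prod_eq_zero_iff] at hz
  rcases hz with hz | hz
  · simp [hc] at hz
  · obtain ⟨a, -, ha⟩ := Multiset.mem_map.1 hz
    have : z = a := by simpa [sub_eq_zero] using ha
    simp [this]

/-! ### Construction of the common interlacer -/

/-- A compatible proper family has a common interlacing polynomial. -/
theorem exists_interlaces_of_compatible {n : ℕ} {f : Fin n → ℝ[X]} (hf : ∀ i, RealRooted (f i))
    (hc : Compatible f) (hp : ProperFamily f) :
    ∃ g : ℝ[X], g ≠ 0 ∧ RealRooted g ∧ ∀ i, Interlaces (f i) g := by
  classical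
  rcases n.eq_zero_or_pos with rfl | hn
  · exact ⟨1, one_ne_zero, Or.inr (by simp), fun i => i.elim0⟩
  have : Nonempty (Fin n) := ⟨⟨0, hn⟩⟩
  have hf0 : ∀ i, f i ≠ 0 := by
    intro i hi
    exact hp (fun j => if j = i then 1 else 0) (fun j => by split_ifs <;> norm_num) (by simp)
      (by simp [hi])
  -- Properness, after rescaling to a convex combination, makes the sum a nonzero polynomial;
  -- compatibility then excludes nonreal zeros.
  have hpoint : ∀ c : Fin n → ℝ, (∀ i, 0 ≤ c i) → 0 < ∑ i, c i → ∀ z : ℂ, 0 < z.im →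
      ∑ i, c i • aeval z (f i) ≠ 0 := by
    intro c hc0 hs z hz
    rw [← aeval_sum_smul]
    refine (hc c hc0).aeval_ne_zero (fun h0 => ?_) (ne_of_gt hz)
    refine hp (fun i => (∑ j, c j)⁻¹ * c i) (fun i => mul_nonneg (inv_nonneg.2 hs.le) (hc0 i))
      (by rw [← Finset.mul_sum, inv_mul_cancel₀ hs.ne']) ?_
    simp only [mul_smul, ← Finset.smul_sum, h0, smul_zero]
  have hI : (0 : ℝ) < Complex.I.im := by simp
  obtain ⟨w, hw⟩ : ∃ w : ℂ, ∀ i, 0 < (aeval Complex.I (f i) * w).re := by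
    have h0 : (0 : ℂ) ∉ convexHull ℝ (Set.range fun i => aeval Complex.I (f i)) := by
      intro hmem
      rw [convexHull_range_eq_exists_affineCombination] at hmem
      obtain ⟨s, c, hc0, hc1, hsum⟩ := hmem
      rw [s.affineCombination_eq_linear_combination _ _ hc1] at hsum
      refine hpoint (fun i => if i ∈ s then c i else 0) (fun i => ?_) ?_ _ hI ?_
      · split_ifs with hi
        · exact hc0 i hi
        · exact le_rfl
      · simp [hc1]
      · simpa [ite_smul, ite_mul] using hsum
    obtain ⟨L, u, hu, hL⟩ := geometric_hahn_banach_point_closed (convex_convexHull ℝ _)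
      ((Set.finite_range _).isCompact_convexHull ℝ).isClosed h0
    rw [map_zero] at hu
    -- This `w` represents the separating functional: `L v = re (v * w)`.
    refine ⟨⟨L 1, -L Complex.I⟩, fun i => ?_⟩
    have h1 := hu.trans (hL _ (subset_convexHull ℝ _ ⟨i, rfl⟩))
    set v := aeval Complex.I (f i)
    have hv : L v = v.re * L 1 + v.im * L Complex.I := by
      have : v = v.re • (1 : ℂ) + v.im • Complex.I := by
        apply Complex.ext <;> simp
      conv_lhs => rw [this]
      simp only [map_add, map_smul, smul_eq_mul]
    rw [hv] at h1
    simpa using h1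
  choose e he hnear using fun i => (hf i).exists_phase_near (hf0 i) (ne_of_gt hI) (hw i)
  have hphase : ∀ i j (z : ℂ), 0 < z.im →
      |phase (f i) (e i) z - phase (f j) (e j) z| < Real.pi := by
    intro i j z hz
    refine abs_phase_sub_lt (hf i) (hf j) (hf0 i) (hf0 j) (he i) (he j) ?_ hI ?_ hz
    · intro z hz a b ha hb h0
      refine hpoint (fun l => (if l = i then a else 0) + if l = j then b else 0)
        (fun l => by split_ifs <;> positivity) ?_ z hz ?_
      · simpa [Finset.sum_add_distrib] using add_pos ha hb
      · simpa [add_smul, Finset.sum_add_distrib, ite_smul, add_mul, ite_mul] using h0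
    -- Both phases at `I` lie within `π / 2` of `-w.arg`.
    · have h1 := abs_lt.1 (hnear i)
      have h2 := abs_lt.1 (hnear j)
      rw [abs_lt]
      constructor <;> linarith [h1.1, h1.2, h2.1, h2.2]
  have hcount : ∀ i j x, e i + (countAbove (f i).roots x : ℤ) ≤
      e j + countAbove (f j).roots x + 1 := fun i j x => countAbove_add_le (hphase i j) x
  set K : ℝ → ℤ := fun x =>
    Finset.univ.sup' Finset.univ_nonempty fun i => e i + (countAbove (f i).roots x : ℤ) with hKdef
  have hle : ∀ i x, e i + (countAbove (f i).roots x : ℤ) ≤ K x := fun i x =>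
    Finset.le_sup' (fun i => e i + (countAbove (f i).roots x : ℤ)) (Finset.mem_univ i)
  have hge : ∀ i x, K x ≤ e i + countAbove (f i).roots x + 1 := fun i x =>
    Finset.sup'_le _ _ fun j _ => hcount j i x
  have hanti : Antitone K := fun x y hxy => Finset.sup'_le _ _ fun i _ =>
    (add_le_add_right (Int.ofNat_le.2 (countAbove_antitone _ hxy)) _).trans (hle i x)
  have hopen : ∀ j, IsOpen {x | j ≤ K x} := by
    intro j
    rw [isOpen_iff_mem_nhds]
    intro x hx
    -- A member whose count reaches `j` at `x` keeps at least that count nearby.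
    obtain ⟨i, -, hi⟩ := (Finset.le_sup'_iff _).1 (show j ≤ K x from hx)
    filter_upwards [eventually_countAbove_ge (f i).roots x] with y hy
    have := hle i y
    show j ≤ K y
    omega
  -- The multiset `u` supplies the roots of the interlacer and the parity of `d` its sign.
  obtain ⟨d, u, hKu⟩ := exists_eq_add_countAbove hanti hopen
    (m := e ⟨0, hn⟩) (M := e ⟨0, hn⟩ + (f ⟨0, hn⟩).roots.card + 1)
    (fun x => by have := hle ⟨0, hn⟩ x; omega)
    (fun x => by
      have := hge ⟨0, hn⟩ x
      have := countAbove_le_card (f ⟨0, hn⟩).roots x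
      omega)
  have hd0 : ((-1 : ℝ) ^ d) ≠ 0 := zpow_ne_zero _ (by norm_num)
  have hmonic : ((u.map fun a => X - C a).prod : ℝ[X]).Monic :=
    monic_multiset_prod_of_monic _ _ fun a _ => monic_X_sub_C a
  have hroots : (C ((-1 : ℝ) ^ d) * (u.map fun a => X - C a).prod).roots = u := by
    rw [roots_C_mul _ hd0, roots_multiset_prod_X_sub_C]
  have hlead : (C ((-1 : ℝ) ^ d) * (u.map fun a => X - C a).prod).leadingCoeff = (-1) ^ d := by
    rw [leadingCoeff_mul, hmonic.leadingCoeff, leadingCoeff_C, mul_one]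
  refine ⟨_, mul_ne_zero (C_ne_zero.2 hd0) hmonic.ne_zero, .C_mul_prod hd0 u, fun i => ?_⟩
  refine interlaces_of_signed_countAbove (hf i) (.C_mul_prod hd0 u) (he i) (e := d) ?_ ?_ ?_
  · rw [hlead, ← sq]
    positivity
  · intro x
    rw [hroots, ← hKu]
    exact hle i x
  · intro x
    rw [hroots, ← hKu]
    exact hge i x

theorem theorem1p2 (n : ℕ) (f : Fin n → ℝ[X]) (hf : ∀ i, RealRooted (f i)) :
    (Compatible f ↔ ∀ i j k : Fin n, Compatible ![f i, f j, f k]) ∧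
    (ProperFamily f →
      List.TFAE [
        Compatible f,
        ∀ i j k : Fin n, Compatible ![f i, f j, f k],
        ∃ g : ℝ[X], g ≠ 0 ∧ RealRooted g ∧ ∀ i, Interlaces (f i) g]) := by
  refine ⟨compatible_iff_triples f, fun hp => ?_⟩
  tfae_have 1 ↔ 2 := compatible_iff_triples f
  tfae_have 1 → 3 := fun hc => exists_interlaces_of_compatible hf hc hp
  tfae_have 3 → 1 := fun ⟨_, hg0, hg, h⟩ => compatible_of_interlaces hg0 hg h
  tfae_finish
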